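/- \textbf{The game.} Let $A\subseteq\mathbb R$ be an interval and $\pi:A\times A\to\mathbb R$ continuous, $\pi(a,b)$ being the payoff of a player who uses $a$ against $b$ in a symmetric two-player stage game, such that $\max_{a'\in A}\pi(a',b)$ exists for every $b\in A$. Let $a^N\in A$ be such that $(a^N,a^N)$ is a Nash equilibrium of the stage game, let $a^*\in A$ maximize $\pi(a,a)$ over $A$, and let $a\mapsto\pi(a,a)$ be strictly increasing on $[a^N,a^*]$ if $a^N<a^*$ (strictly decreasing on $[a^*,a^N]$ if $a^*<a^N$). Write $G(a)=\max_{a'\in A}\pi(a',a)-\pi(a,a)$ and $L(a)=\pi(a,a)-\pi(a^N,a^N)$. In the revision game with horizon $T>0$ and rate $\lambda>0$ the two players choose actions simultaneously when the remaining time is $T$, and again at each arrival of a Poisson process of rate $\lambda$ until the remaining time is $0$; the payoffs are the stage payoffs of the action profile chosen at the last of these opportunities. A strategy chooses, at each opportunity, an action in $A$ as a (measurable) function of the remaining time and of the history of all earlier opportunities and actions. A subgame starts with an opportunity at a remaining time $t\in[0,T]$ after an arbitrary history of earlier opportunities. For $\varepsilon\ge0$, a strategy profile is an $\varepsilon$-subgame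 perfect equilibrium ($\varepsilon$-SPE) if in every subgame, on or off the path of play, the expected payoffs are finite and no player can raise her expected payoff by more than $\varepsilon$ by switching to another strategy. \textbf{LR strategies.} For a plan $x:[0,T]\to A$ and $k\in(0,1)$, the limited retaliation (LR) strategy $\{x,k\}$ plays $x(t)$ at an opportunity with remaining time $t$ outside of retaliation phases and $a^N$ inside them; if at an opportunity with remaining time $s$ outside of retaliation phases some player does not choose $x(s)$, a retaliation phase covers all later opportunities with remaining time in $[s-ks,s)$, whatever is played during it. \textbf{Corollary.} Let $k\in(0,1)$, $\kappa=1-k$, $\varepsilon\ge 0$, and $\tau(n)=k\kappa^{n-1}T$ for $n\ge1$. Let $(a_n)_{n\ge1}$ satisfy $a^N\le a_{n+1}\le a_n\le a^*$ for all $n\ge1$ (all inequalities reversed if $a^*<a^N$). Suppose that \begin{enumerate} \item the plan is piecewise constant: $x(t)=a_n$ for $t\in[\kappa^nT,\kappa^{n-1}T)$, $n\ge1$, with $x(T)=a_1$ and $x(0)=a^N$; \item $G(a_n)e^{-\lambda\tau(n+1)}\le L(a_{n+1})\bigl(1-e^{-\lambda\tau(n+1)}\bigr)$ for all $n\ge1$;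 \item for some $c\ge1$, $\;G(a_c)e^{-\lambda\tau(c)}\le L(a_c)\bigl(1-e^{-\lambda\tau(c)}\bigr)+\varepsilon$. \end{enumerate} Then the profile in which both players use the LR strategy $\{x,k\}$ is an $\varepsilon$-SPE. -/

import Mathlib

open MeasureTheory ProbabilityTheory Set

noncomputable section

/-- A two-player symmetric revision game. The stage game has the action interval `A`, and
`π a b` is the payoff of a player who uses `a` against `b`. Revision opportunities arrive at
Poisson rate `lam` during the time span `[-T, 0]`. Both orders `aN < aStar` and `aStar < aN` of the
Nash and the optimal action are allowed. -/
structure RevisionGame where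
  A : Set ℝ
  convex_A : Convex ℝ A
  π : ℝ → ℝ → ℝ
  continuousOn_π : ContinuousOn (Function.uncurry π) (A ×ˢ A)
  /-- best replies exist, so that the maximum in the deviation gain is attained -/
  exists_best_reply : ∀ b ∈ A, ∃ a ∈ A, ∀ a' ∈ A, π a' b ≤ π a b
  aN : ℝ
  aN_mem : aN ∈ A
  nash : ∀ a ∈ A, π a aN ≤ π aN aN
  aStar : ℝ
  aStar_mem : aStar ∈ A
  optimal : ∀ a ∈ A, π a a ≤ π aStar aStar
  strictMono_diag : aN < aStar → StrictMonoOn (fun a => π a a) (Icc aN aStar)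
  strictAnti_diag : aStar < aN → StrictAntiOn (fun a => π a a) (Icc aStar aN)
  lam : ℝ
  lam_pos : 0 < lam
  T : ℝ
  T_pos : 0 < T

/-- A public history: the past revision opportunities, most recent first, each recorded as the
remaining time at which it arrived together with the action profile chosen there. -/
abbrev History : Type := List (ℝ × (Fin 2 → ℝ))

/-- A behaviour rule for one player: the action to be taken when an opportunity arrives with
remaining time `t` after the history `h`. -/
abbrev Strategy : Type := History → ℝ → ℝ

namespace RevisionGame

variable (Γ : RevisionGame)

/-- `G a`, the maximal gain from a deviation from `(a, a)` in the stage game. -/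
def gain (a : ℝ) : ℝ := sSup ((fun a' => Γ.π a' a) '' Γ.A) - Γ.π a a

/-- `L a`, the loss from playing `(aN, aN)` instead of `(a, a)` in the stage game. -/
def loss (a : ℝ) : ℝ := Γ.π a a - Γ.π Γ.aN Γ.aN

/-- The stage payoff of player `i` at the action profile `p`. -/
def stagePayoff (i : Fin 2) (p : Fin 2 → ℝ) : ℝ := Γ.π (p i) (p i.rev)

/-- `h` is a possible history before an opportunity with remaining time `t`: the initial choice is
made at remaining time `T`, and remaining times strictly decrease. -/
def IsHistory : History → ℝ → Prop
  | [], t => t = Γ.T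
  | e :: h, t => t < e.1 ∧ (∀ i, e.2 i ∈ Γ.A) ∧ IsHistory h e.1

/-- Strategies choose feasible actions and are measurable in the history and the time. -/
def Admissible (τ : Strategy) : Prop :=
  (∀ h t, τ h t ∈ Γ.A) ∧
    ∀ n : ℕ, Measurable
      (fun p : (Fin n → ℝ × (Fin 2 → ℝ)) × ℝ => τ (List.ofFn p.1) p.2)

/-- The remaining time at the `n`-th opportunity (counted from `0`) of a subgame that starts with
an opportunity at remaining time `t`, if the waiting times are `ω 0, ω 1, …`. -/
def remaining (t : ℝ) (ω : ℕ → ℝ) (n : ℕ) : ℝ := t - ∑ m ∈ Finset.range n, ω m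

/-- The history before the `n`-th opportunity of the subgame that starts with an opportunity at
remaining time `t` after the history `h`, when the players use the strategies `σ`. -/
def play (σ : Fin 2 → Strategy) (h : History) (t : ℝ) (ω : ℕ → ℝ) : ℕ → History
  | 0 => h
  | n + 1 => (remaining t ω n, fun i => σ i (play σ h t ω n) (remaining t ω n)) :: play σ h t ω n

/-- The index of the final revision opportunity: the first one whose successor would arrive after
the deadline. -/
def lastIndex (t : ℝ) (ω : ℕ → ℝ) : ℕ := sInf {n : ℕ | remaining t ω (n + 1) < 0}

/-- The payoff that is realized at the deadline: the stage payoff of the profile chosen at the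
final revision opportunity. -/
def realizedPayoff (σ : Fin 2 → Strategy) (h : History) (t : ℝ) (i : Fin 2) (ω : ℕ → ℝ) : ℝ :=
  Γ.stagePayoff i fun j =>
    σ j (play σ h t ω (lastIndex t ω)) (remaining t ω (lastIndex t ω))

/-- The law of the waiting times of a Poisson process of rate `lam`: independent, exponential. -/
def arrivalLaw : Measure (ℕ → ℝ) :=
  haveI : IsProbabilityMeasure (expMeasure Γ.lam) := isProbabilityMeasure_expMeasure Γ.lam_pos
  Measure.infinitePi (fun _ : ℕ => expMeasure Γ.lam)

/-- The expected payoff of player `i` in the subgame at `(h, t)`, as an extended real number (a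
deviation may have expected payoff `-∞`). -/
def expectedPayoff (σ : Fin 2 → Strategy) (h : History) (t : ℝ) (i : Fin 2) : EReal :=
  ((∫⁻ ω, ENNReal.ofReal (Γ.realizedPayoff σ h t i ω) ∂Γ.arrivalLaw : ENNReal) : EReal) -
    ((∫⁻ ω, ENNReal.ofReal (-Γ.realizedPayoff σ h t i ω) ∂Γ.arrivalLaw : ENNReal) : EReal)

/-- `ε`-subgame perfect equilibrium: in every subgame (on or off the equilibrium path) the expected
payoffs are finite and no player can gain more than `ε` by any other strategy. -/
def IsApproxSPE (ε : ℝ) (σ : Fin 2 → Strategy) : Prop :=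
  (∀ i, Γ.Admissible (σ i)) ∧
    ∀ (h : History) (t : ℝ), Γ.IsHistory h t → 0 ≤ t → ∀ i : Fin 2,
      Integrable (Γ.realizedPayoff σ h t i) Γ.arrivalLaw ∧
        ∀ τ : Strategy, Γ.Admissible τ →
          Γ.expectedPayoff (Function.update σ i τ) h t i ≤ Γ.expectedPayoff σ h t i + (ε : EReal)

/-- With plan `x` and coefficient `k`: is an opportunity at remaining time `t` after the history
`h` inside a retaliation phase? A deviation at remaining time `s` outside of retaliation phases
triggers one that lasts until the remaining time is `s - k * s`; actions chosen during a
retaliation phase have no influence. -/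
def InRetaliation (x : ℝ → ℝ) (k : ℝ) : History → ℝ → Prop
  | [], _ => False
  | e :: h, t =>
      (InRetaliation x k h e.1 ∧ InRetaliation x k h t) ∨
        (¬ InRetaliation x k h e.1 ∧ (∃ i, e.2 i ≠ x e.1) ∧ e.1 - k * e.1 ≤ t)

open Classical in
/-- The limited retaliation strategy `{x, k}`. -/
def lrStrategy (x : ℝ → ℝ) (k : ℝ) : Strategy := fun h t =>
  if InRetaliation x k h t then Γ.aN else x t

/-- The slot of the remaining time `t`: the number `n ≥ 1` with
`(1 - k)^n * T ≤ t < (1 - k)^(n-1) * T`, and `1` at the initial time `t = T`. -/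
def slot (k t : ℝ) : ℕ := max 1 (sInf {n : ℕ | (1 - k) ^ n * Γ.T ≤ t})

/-- The piecewise constant plan with action `a n` in the `n`-th slot, `n ≥ 1`. At the deadline
itself it is the Nash action of the stage game, which is the smallest subgame. -/
def pcPlan (k : ℝ) (a : ℕ → ℝ) (t : ℝ) : ℝ := if t ≤ 0 then Γ.aN else a (Γ.slot k t)

theorem pcPlan_eq {k t : ℝ} (hk : k ∈ Ioo (0 : ℝ) 1) (a : ℕ → ℝ) {n : ℕ} (hn : 1 ≤ n)
    (h₁ : (1 - k) ^ n * Γ.T ≤ t) (h₂ : t < (1 - k) ^ (n - 1) * Γ.T) :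
    Γ.pcPlan k a t = a n := by
  have hκ : 0 < 1 - k := by linarith [hk.2]
  have hT := Γ.T_pos
  have ht : ¬ t ≤ 0 := not_le.mpr (lt_of_lt_of_le (by positivity) h₁)
  have hs : sInf {m : ℕ | (1 - k) ^ m * Γ.T ≤ t} = n := by
    refine le_antisymm (Nat.sInf_le h₁) ?_
    refine le_csInf ⟨n, h₁⟩ fun m hm => ?_
    by_contra hlt
    have hle : (1 - k) ^ (n - 1) ≤ (1 - k) ^ m :=
      pow_le_pow_of_le_one hκ.le (by linarith [hk.1]) (by omega)
    have := mul_le_mul_of_nonneg_right hle hT.le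
    have hm' : (1 - k) ^ m * Γ.T ≤ t := hm
    linarith
  simp only [pcPlan, ht, if_false, slot, hs, max_eq_right hn]

theorem pcPlan_T (k : ℝ) (a : ℕ → ℝ) : Γ.pcPlan k a Γ.T = a 1 := by
  have h0 : sInf {n : ℕ | (1 - k) ^ n * Γ.T ≤ Γ.T} = 0 :=
    Nat.sInf_eq_zero.mpr (Or.inl (by simp))
  unfold pcPlan slot
  rw [if_neg (not_le.mpr Γ.T_pos), h0]
  rfl

/-- The actions are cooperative, at most `aStar`, and monotone towards `aN`. If `aN < aStar` this
says `aN ≤ a (n+1) ≤ a n ≤ aStar`; if `aStar < aN`, the reverse inequalities. -/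
def IsMonotoneBounded (a : ℕ → ℝ) : Prop :=
  ∀ n, 1 ≤ n → a n ∈ uIcc Γ.aN Γ.aStar ∧ a (n + 1) ∈ uIcc Γ.aN (a n)

/-- The length `τ(n)` of the `n`-th slot, `n ≥ 1`. -/
def slotLength (k : ℝ) (n : ℕ) : ℝ := k * (1 - k) ^ (n - 1) * Γ.T

/-- The recurrence relation. -/
def Recurrence (k : ℝ) (a : ℕ → ℝ) : Prop :=
  ∀ n, 1 ≤ n →
    Γ.gain (a n) * Real.exp (-Γ.lam * Γ.slotLength k (n + 1)) ≤
      Γ.loss (a (n + 1)) * (1 - Real.exp (-Γ.lam * Γ.slotLength k (n + 1)))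

/-- The terminal condition up to `ε`. -/
def ApproxTerminal (ε k : ℝ) (a : ℕ → ℝ) : Prop :=
  ∃ c, 1 ≤ c ∧
    Γ.gain (a c) * Real.exp (-Γ.lam * Γ.slotLength k c) ≤
      Γ.loss (a c) * (1 - Real.exp (-Γ.lam * Γ.slotLength k c)) + ε

end RevisionGame

end

/-! No single deviation pays. One made at remaining time `t` in slot `n` affects the payoff directly
only if no opportunity follows, which has probability `e^{-λt}`, and then gains at most `G(a_n)`.
The phase it triggers lies in slots `n` and `n+1`, so by monotonicity it costs at least `L(a_{n+1})`
when the final opportunity falls into it, which has probability `e^{-λ(t-kt)} - e^{-λt}`. Since `kt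
≥ τ(n+1)`, the recurrence makes the cost outweigh the gain (`exists_deterrent`). After the phase the
plan resumes unchanged; inside a phase the Nash action is a best reply and actions have no
consequences (`value_le_deviate`).

Arbitrary deviations are reduced to single ones by dynamic programming
(`le_lintegral_finalProfile`). Payoffs against limited retaliation are bounded above by some `C` but
possibly not below, so the argument uses the nonnegative shortfall `C - π`, for which no
integrability is needed. The remaining time of the final opportunity has an atom of mass `e^{-λt}`
at the start `t` and density `λe^{-λs}` on `[0,t]`; `value` integrates against this law, and
`lintegral_value` is its renewal identity. The value of the shortfall along the prescribed path is a
sub-solution against every deviating strategy, hence a lower bound for the deviator's shortfall. The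
same lemma bounds from below the excess over `π(aN,aN)` earned by conforming. The two bounds add up
to `C - π(aN,aN)`, which says that deviating gains nothing. -/

/-! ### Renewal of an i.i.d. sequence -/

/-- Prepend a waiting time to a sequence of waiting times. -/
def consSeq (p : ℝ × (ℕ → ℝ)) : ℕ → ℝ
  | 0 => p.1
  | n + 1 => p.2 n

theorem measurable_consSeq : Measurable consSeq := by
  refine measurable_pi_iff.mpr fun n => ?_
  cases n with
  | zero => exact measurable_fst
  | succ n => exact (measurable_pi_apply n).comp measurable_snd

/-- An infinite product measure is determined by finite boxes. The preimage of a box splits into a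
condition on the first coordinate and a box in the shifted ones. This allows conditioning on the
first waiting time. -/
theorem map_consSeq_infinitePi (μ : Measure ℝ) [IsProbabilityMeasure μ] :
    (μ.prod (Measure.infinitePi fun _ : ℕ => μ)).map consSeq =
      Measure.infinitePi fun _ : ℕ => μ := by
  refine Measure.eq_infinitePi _ fun s t ht => ?_
  rw [Measure.map_apply measurable_consSeq (MeasurableSet.pi s.countable_toSet fun i _ => ht i)]
  -- Padding with `univ` turns the box over `s` into one over an initial segment, where the shift of
  -- indices is a bijection.
  set t' : ℕ → Set ℝ := fun n => if n ∈ s then t n else univ with ht'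
  have ht'm : ∀ n, MeasurableSet (t' n) := by
    intro n
    simp only [ht']
    split_ifs
    exacts [ht n, MeasurableSet.univ]
  obtain ⟨N, hN⟩ : ∃ N, s ⊆ Finset.range (N + 1) :=
    ⟨s.sup id, fun i hi => Finset.mem_range.mpr (Nat.lt_succ_of_le (Finset.le_sup (f := id) hi))⟩
  have hset : consSeq ⁻¹' (Set.pi s t) =
      t' 0 ×ˢ Set.pi (Finset.range N : Set ℕ) (fun n => t' (n + 1)) := by
    ext ⟨w, ω⟩
    simp only [mem_preimage, Set.mem_pi, mem_prod, Finset.mem_coe, Finset.mem_range, ht']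
    constructor
    · intro h
      refine ⟨?_, fun n _ => ?_⟩
      · split_ifs with h0
        exacts [h 0 h0, mem_univ _]
      · split_ifs with h0
        exacts [h (n + 1) h0, mem_univ _]
    · rintro ⟨h0, h1⟩ n hn
      cases n with
      | zero => rwa [if_pos hn] at h0
      | succ n =>
        have := h1 n (by have := Finset.mem_range.mp (hN hn); omega)
        rwa [if_pos hn] at this
  rw [hset, Measure.prod_prod, Measure.infinitePi_pi (fun _ : ℕ => μ) (fun n _ => ht'm (n + 1)),
    mul_comm, ← Finset.prod_range_succ' (fun n => μ (t' n)), ← Finset.prod_subset hN]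
  · exact Finset.prod_congr rfl fun n hn => by simp [ht', hn]
  · intro n _ hn
    simp [ht', hn]

namespace RevisionGame

variable (Γ : RevisionGame)

/-! ### Exponential waiting times -/

/-- The law of a single waiting time. -/
noncomputable abbrev waitLaw : Measure ℝ := expMeasure Γ.lam

instance : IsProbabilityMeasure Γ.waitLaw := isProbabilityMeasure_expMeasure Γ.lam_pos

theorem arrivalLaw_eq : Γ.arrivalLaw = Measure.infinitePi fun _ : ℕ => Γ.waitLaw := rfl

instance : IsProbabilityMeasure Γ.arrivalLaw := by
  rw [arrivalLaw_eq]; infer_instance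

theorem map_consSeq : (Γ.waitLaw.prod Γ.arrivalLaw).map consSeq = Γ.arrivalLaw :=
  map_consSeq_infinitePi _

theorem lintegral_arrivalLaw {f : (ℕ → ℝ) → ENNReal} (hf : Measurable f) :
    ∫⁻ ω, f ω ∂Γ.arrivalLaw =
      ∫⁻ w, ∫⁻ ω, f (consSeq (w, ω)) ∂Γ.arrivalLaw ∂Γ.waitLaw := by
  conv_lhs => rw [← Γ.map_consSeq]
  rw [lintegral_map hf measurable_consSeq]
  exact lintegral_prod _ (hf.comp measurable_consSeq).aemeasurable

theorem waitLaw_Iic {t : ℝ} (ht : 0 ≤ t) :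
    Γ.waitLaw (Iic t) = ENNReal.ofReal (1 - Real.exp (-(Γ.lam * t))) := by
  have h := cdf_expMeasure_eq Γ.lam_pos t
  rw [if_pos ht, cdf_eq_real] at h
  rw [← h, ofReal_measureReal]

theorem waitLaw_Ioi {t : ℝ} (ht : 0 ≤ t) :
    Γ.waitLaw (Ioi t) = ENNReal.ofReal (Real.exp (-(Γ.lam * t))) := by
  rw [← compl_Iic, prob_compl_eq_one_sub measurableSet_Iic, Γ.waitLaw_Iic ht,
    ← ENNReal.ofReal_one, ← ENNReal.ofReal_sub _ (by
      have : 0 ≤ Γ.lam * t := mul_nonneg Γ.lam_pos.le ht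
      rw [sub_nonneg, Real.exp_le_one_iff]; linarith)]
  congr 1
  ring

theorem waitLaw_eq : Γ.waitLaw = volume.withDensity (exponentialPDF Γ.lam) := rfl

theorem waitLaw_Iio_zero : Γ.waitLaw (Iio 0) = 0 := by
  rw [waitLaw_eq, withDensity_apply _ measurableSet_Iio]
  exact lintegral_exponentialPDF_of_nonpos le_rfl

theorem waitLaw_singleton (s : ℝ) : Γ.waitLaw {s} = 0 := by
  rw [waitLaw_eq]
  exact withDensity_absolutelyContinuous _ _ (measure_singleton s)

theorem waitLaw_Icc_zero {t : ℝ} (ht : 0 ≤ t) :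
    Γ.waitLaw (Icc 0 t) = ENNReal.ofReal (1 - Real.exp (-(Γ.lam * t))) := by
  rw [← Γ.waitLaw_Iic ht, ← Iio_union_Icc_eq_Iic ht]
  rw [measure_union _ measurableSet_Icc, waitLaw_Iio_zero, zero_add]
  exact (disjoint_left.mpr fun x hx hx' => absurd hx'.1 (not_le.mpr hx))

theorem setLIntegral_waitLaw (t : ℝ) (g : ℝ → ENNReal) (hg : Measurable g) :
    ∫⁻ w in Icc 0 t, g w ∂Γ.waitLaw =
      ∫⁻ w in Icc 0 t, g w * ENNReal.ofReal (Γ.lam * Real.exp (-(Γ.lam * w))) := by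
  have hm : Measurable (exponentialPDF Γ.lam) :=
    ENNReal.measurable_ofReal.comp (measurable_exponentialPDFReal _)
  rw [waitLaw_eq, setLIntegral_withDensity_eq_setLIntegral_mul _ hm hg measurableSet_Icc]
  refine setLIntegral_congr_fun measurableSet_Icc fun w hw => ?_
  simp only [Pi.mul_apply]
  rw [exponentialPDF_of_nonneg hw.1, mul_comm]

theorem setLIntegral_Icc_reflect (t : ℝ) (g : ℝ → ENNReal) :
    ∫⁻ w in Icc 0 t, g (t - w) = ∫⁻ w in Icc 0 t, g w := by
  rw [← lintegral_indicator measurableSet_Icc, ← lintegral_indicator measurableSet_Icc,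
    ← lintegral_sub_left_eq_self _ t]
  congr 1
  ext w
  by_cases hw : w ∈ Icc 0 t
  · rw [indicator_of_mem hw, indicator_of_mem]
    · simp
    · exact ⟨by linarith [hw.2], by linarith [hw.1]⟩
  · rw [indicator_of_notMem hw, indicator_of_notMem]
    exact fun h => hw ⟨by linarith [h.2], by linarith [h.1]⟩

/-! ### Law of the final opportunity -/

/-- The expected value of `φ` at the remaining time of the final opportunity of a subgame that
starts with an opportunity at remaining time `t`. -/
noncomputable def value (φ : ℝ → ENNReal) (t : ℝ) : ENNReal :=
  φ t * Γ.waitLaw (Ioi t) + ∫⁻ s in Icc 0 t, φ s ∂Γ.waitLaw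

theorem value_add {φ : ℝ → ENNReal} (hφ : Measurable φ) (ψ : ℝ → ENNReal) (t : ℝ) :
    Γ.value (fun s => φ s + ψ s) t = Γ.value φ t + Γ.value ψ t := by
  simp only [value]
  rw [lintegral_add_left hφ]
  ring

theorem value_const (C : ENNReal) {t : ℝ} (ht : 0 ≤ t) : Γ.value (fun _ => C) t = C := by
  simp only [value]
  rw [setLIntegral_const, ← mul_add, Γ.waitLaw_Ioi ht, Γ.waitLaw_Icc_zero ht,
    ← ENNReal.ofReal_add (Real.exp_pos _).le]
  · simp
  · have : 0 ≤ Γ.lam * t := mul_nonneg Γ.lam_pos.le ht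
    rw [sub_nonneg, Real.exp_le_one_iff]; linarith

theorem value_le {φ : ℝ → ENNReal} {B : ENNReal} (hφ : ∀ s, φ s ≤ B) {t : ℝ} (ht : 0 ≤ t) :
    Γ.value φ t ≤ B := by
  rw [← Γ.value_const B ht]
  exact add_le_add (mul_le_mul_left (hφ t) _) (lintegral_mono fun s => hφ s)

/-- After a first wait `w ≤ t` the subgame restarts at `t - w`. The atom there contributes the
density `λe^{-λt}` at `s = t - w`, and the continuous part contributes, by Tonelli, `λe^{-λs}(1 -
e^{-λ(t-s)})`. The sum is `λe^{-λs}`. -/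
theorem lintegral_value {φ : ℝ → ENNReal} (hφ : Measurable φ) {t : ℝ} :
    ∫⁻ w in Icc 0 t, Γ.value φ (t - w) ∂Γ.waitLaw = ∫⁻ s in Icc 0 t, φ s ∂Γ.waitLaw := by
  have hl := Γ.lam_pos
  have hexp : ∀ x : ℝ, 0 ≤ x → 0 ≤ 1 - Real.exp (-(Γ.lam * x)) := fun x hx => by
    have : 0 ≤ Γ.lam * x := mul_nonneg hl.le hx
    rw [sub_nonneg, Real.exp_le_one_iff]; linarith
  have hm1 : Measurable fun w => φ (t - w) * Γ.waitLaw (Ioi (t - w)) := by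
    refine Measurable.mul (hφ.comp (by fun_prop)) ?_
    exact Monotone.measurable fun a b hab => measure_mono (Ioi_subset_Ioi (by linarith))
  have h1 : ∫⁻ w in Icc 0 t, φ (t - w) * Γ.waitLaw (Ioi (t - w)) ∂Γ.waitLaw =
      ∫⁻ s in Icc 0 t, φ s * ENNReal.ofReal (Γ.lam * Real.exp (-(Γ.lam * t))) := by
    rw [Γ.setLIntegral_waitLaw t _ hm1, ← setLIntegral_Icc_reflect t]
    refine setLIntegral_congr_fun measurableSet_Icc fun w hw => ?_
    simp only [sub_sub_cancel]
    rw [Γ.waitLaw_Ioi hw.1, mul_assoc, ← ENNReal.ofReal_mul (Real.exp_pos _).le]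
    congr 2
    rw [mul_left_comm, ← Real.exp_add]
    ring_nf
  have h2 : ∫⁻ w in Icc 0 t, ∫⁻ s in Icc 0 (t - w), φ s ∂Γ.waitLaw ∂Γ.waitLaw =
      ∫⁻ s in Icc 0 t, φ s * Γ.waitLaw (Icc 0 (t - s)) ∂Γ.waitLaw := by
    have e1 : ∀ w ∈ Icc 0 t, ∫⁻ s in Icc 0 (t - w), φ s ∂Γ.waitLaw =
        ∫⁻ s in Icc 0 t, φ s * {p : ℝ × ℝ | p.1 + p.2 ≤ t}.indicator 1 (w, s) ∂Γ.waitLaw := by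
      intro w hw
      rw [← lintegral_indicator measurableSet_Icc, ← lintegral_indicator measurableSet_Icc]
      congr 1
      ext s
      by_cases hs : s ∈ Icc 0 (t - w)
      · have hs' : s ∈ Icc 0 t := ⟨hs.1, by linarith [hs.2, hw.1]⟩
        rw [indicator_of_mem hs, indicator_of_mem hs', indicator_of_mem]
        · simp
        · show w + s ≤ t
          linarith [hs.2]
      · rw [indicator_of_notMem hs]
        by_cases hs' : s ∈ Icc 0 t
        · rw [indicator_of_mem hs', indicator_of_notMem, mul_zero]
          exact fun h => hs ⟨hs'.1, by have : w + s ≤ t := h; linarith⟩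
        · rw [indicator_of_notMem hs']
    rw [setLIntegral_congr_fun measurableSet_Icc e1, lintegral_lintegral_swap]
    · refine setLIntegral_congr_fun measurableSet_Icc fun s hs => ?_
      have hmi : MeasurableSet {w : ℝ | w + s ≤ t} :=
        measurableSet_le (by fun_prop) (by fun_prop)
      have e2 : ∀ w, {p : ℝ × ℝ | p.1 + p.2 ≤ t}.indicator (1 : ℝ × ℝ → ENNReal) (w, s) =
          {w : ℝ | w + s ≤ t}.indicator 1 w := fun w => rfl
      simp only [e2]
      rw [lintegral_const_mul _ (measurable_one.indicator hmi), lintegral_indicator_one hmi,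
        Measure.restrict_apply hmi]
      congr 2
      ext w
      simp only [mem_inter_iff, mem_ofPred_eq, mem_Icc]
      constructor
      · rintro ⟨h1, h2, h3⟩; exact ⟨h2, by linarith⟩
      · rintro ⟨h1, h2⟩; exact ⟨by linarith, h1, by linarith [hs.1]⟩
    · refine Measurable.aemeasurable (Measurable.mul (hφ.comp measurable_snd) ?_)
      exact measurable_one.indicator (measurableSet_le (by fun_prop) (by fun_prop))
  have hm2 : Measurable fun s => φ s * Γ.waitLaw (Icc 0 (t - s)) := by
    refine hφ.mul (Antitone.measurable fun a b hab => measure_mono ?_)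
    exact Icc_subset_Icc_right (by linarith)
  simp only [value]
  rw [lintegral_add_left hm1, h1, h2, Γ.setLIntegral_waitLaw t _ hm2,
    Γ.setLIntegral_waitLaw t _ hφ, ← lintegral_add_left (by fun_prop)]
  refine setLIntegral_congr_fun measurableSet_Icc fun s hs => ?_
  have hts : 0 ≤ t - s := by linarith [hs.2]
  rw [Γ.waitLaw_Icc_zero hts, mul_assoc, ← mul_add, ← ENNReal.ofReal_mul (hexp _ hts),
    ← ENNReal.ofReal_add (mul_pos hl (Real.exp_pos _)).le
      (mul_nonneg (hexp _ hts) (mul_pos hl (Real.exp_pos _)).le)]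
  congr 2
  have : Real.exp (-(Γ.lam * t)) = Real.exp (-(Γ.lam * (t - s))) * Real.exp (-(Γ.lam * s)) := by
    rw [← Real.exp_add]; ring_nf
  rw [this]
  ring

/-- Almost surely all waits are nonnegative and some wait exceeds `t`, since `N` independent waits
are all at most `t` with probability `q ^ N`, where `q < 1`. This excludes the default value `sInf ∅
= 0` in `lastIndex`. -/
theorem ae_exists_remaining_neg {t : ℝ} (ht : 0 ≤ t) :
    ∀ᵐ ω ∂Γ.arrivalLaw, ∃ n, remaining t ω (n + 1) < 0 := by
  have hpos : ∀ᵐ ω ∂Γ.arrivalLaw, ∀ n, 0 ≤ ω n := by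
    rw [ae_all_iff]
    intro n
    have h : ∀ᵐ w ∂Γ.waitLaw, 0 ≤ w := by
      rw [ae_iff]
      simp only [not_le]
      exact Γ.waitLaw_Iio_zero
    exact (measurePreserving_eval_infinitePi (fun _ : ℕ => Γ.waitLaw) n).quasiMeasurePreserving.ae h
  have hlarge : ∀ᵐ ω ∂Γ.arrivalLaw, ∃ n, t < ω n := by
    rw [ae_iff]
    set q := Γ.waitLaw (Iic t) with hq
    have hq1 : q < 1 := by
      rw [hq, Γ.waitLaw_Iic ht, ENNReal.ofReal_lt_one]
      linarith [Real.exp_pos (-(Γ.lam * t))]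
    have hle : ∀ N : ℕ, Γ.arrivalLaw {ω | ¬ ∃ n, t < ω n} ≤ q ^ N := by
      intro N
      have h := Measure.infinitePi_pi (fun _ : ℕ => Γ.waitLaw) (s := Finset.range N)
        (t := fun _ => Iic t) (fun _ _ => measurableSet_Iic)
      rw [Finset.prod_const, Finset.card_range] at h
      rw [hq, ← h]
      refine measure_mono fun ω hω n _ => ?_
      have hω' : ¬ ∃ n, t < ω n := hω
      push Not at hω'
      exact hω' n
    exact le_antisymm (ge_of_tendsto' (ENNReal.tendsto_pow_atTop_nhds_zero_of_lt_one hq1) hle)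
      zero_le
  filter_upwards [hpos, hlarge] with ω h1 h2
  obtain ⟨n, hn⟩ := h2
  refine ⟨n, ?_⟩
  have : ω n ≤ ∑ m ∈ Finset.range (n + 1), ω m :=
    Finset.single_le_sum (fun m _ => h1 m) (Finset.self_mem_range_succ n)
  simp only [remaining]
  linarith

/-! ### Play after the first waiting time -/

theorem remaining_consSeq (t w : ℝ) (ω : ℕ → ℝ) (n : ℕ) :
    remaining t (consSeq (w, ω)) (n + 1) = remaining (t - w) ω n := by
  simp only [remaining, Finset.sum_range_succ', consSeq]
  ring

theorem remaining_zero (t : ℝ) (ω : ℕ → ℝ) : remaining t ω 0 = t := by simp [remaining]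

/-- The action profile chosen at an opportunity. -/
def profile (σ : Fin 2 → Strategy) (h : History) (t : ℝ) : Fin 2 → ℝ := fun i => σ i h t

theorem play_consSeq (σ : Fin 2 → Strategy) (h : History) (t w : ℝ) (ω : ℕ → ℝ) (n : ℕ) :
    play σ h t (consSeq (w, ω)) (n + 1) = play σ ((t, profile σ h t) :: h) (t - w) ω n := by
  induction n with
  | zero => simp only [play, remaining_zero]; rfl
  | succ n ih =>
    rw [play, ih, remaining_consSeq]
    rfl

/-- The action profile chosen at the final opportunity. -/
noncomputable def finalProfile (σ : Fin 2 → Strategy) (h : History) (t : ℝ) (ω : ℕ → ℝ) : Fin 2 → ℝ :=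
  profile σ (play σ h t ω (lastIndex t ω)) (remaining t ω (lastIndex t ω))

theorem finalProfile_consSeq_of_lt (σ : Fin 2 → Strategy) (h : History) {t w : ℝ} (hw : t < w)
    (ω : ℕ → ℝ) : finalProfile σ h t (consSeq (w, ω)) = profile σ h t := by
  have h0 : lastIndex t (consSeq (w, ω)) = 0 := by
    refine Nat.sInf_eq_zero.mpr (Or.inl ?_)
    show remaining t (consSeq (w, ω)) (0 + 1) < 0
    rw [remaining_consSeq, remaining_zero]
    linarith
  rw [finalProfile, h0, remaining_zero]
  rfl

/-- The hypothesis `hω` is essential: if the deadline were never passed, both indices would be the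
default `0` and would not differ by one. -/
theorem finalProfile_consSeq_of_le (σ : Fin 2 → Strategy) (h : History) {t w : ℝ} (hw : w ≤ t)
    {ω : ℕ → ℝ} (hω : ∃ n, remaining (t - w) ω (n + 1) < 0) :
    finalProfile σ h t (consSeq (w, ω)) =
      finalProfile σ ((t, profile σ h t) :: h) (t - w) ω := by
  have h1 : lastIndex t (consSeq (w, ω)) = lastIndex (t - w) ω + 1 := by
    have hmem : remaining (t - w) ω (lastIndex (t - w) ω + 1) < 0 := Nat.sInf_mem hω
    refine le_antisymm (Nat.sInf_le ?_) (le_csInf ⟨lastIndex (t - w) ω + 1, ?_⟩ ?_)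
    · show remaining t _ _ < 0
      rwa [remaining_consSeq]
    · show remaining t _ _ < 0
      rwa [remaining_consSeq]
    · intro n hn
      have hn' : remaining t (consSeq (w, ω)) (n + 1) < 0 := hn
      rw [remaining_consSeq] at hn'
      cases n with
      | zero => rw [remaining_zero] at hn'; linarith
      | succ n => exact Nat.succ_le_succ (Nat.sInf_le hn')
  rw [finalProfile, h1, play_consSeq, remaining_consSeq]
  rfl

/-! ### Measurability of play and payoffs -/

section Measurability

variable {Ω : Type*} [MeasurableSpace Ω]

/-- A random history of fixed length with measurable entries. -/
def MeasurableHistory (f : Ω → History) : Prop :=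
  ∃ (m : ℕ) (g : Ω → Fin m → ℝ × (Fin 2 → ℝ)), Measurable g ∧ ∀ ω, f ω = List.ofFn (g ω)

theorem measurableHistory_const (h : History) : MeasurableHistory fun _ : Ω => h :=
  ⟨h.length, fun _ => h.get, measurable_const, fun _ => (List.ofFn_get h).symm⟩

theorem MeasurableHistory.cons {f : Ω → History} (hf : MeasurableHistory f)
    {e : Ω → ℝ × (Fin 2 → ℝ)} (he : Measurable e) : MeasurableHistory fun ω => e ω :: f ω := by
  obtain ⟨m, g, hg, hfg⟩ := hf
  refine ⟨m + 1, fun ω => Fin.cons (e ω) (g ω), ?_, fun ω => ?_⟩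
  · refine measurable_pi_iff.mpr fun j => ?_
    refine Fin.cases ?_ (fun j => ?_) j
    · simpa using he
    · simp only [Fin.cons_succ]
      exact (measurable_pi_apply j).comp hg
  · simp [List.ofFn_succ, hfg ω]

theorem Admissible.measurable_comp {τ : Strategy} (hτ : Γ.Admissible τ) {f : Ω → History}
    (hf : MeasurableHistory f) {r : Ω → ℝ} (hr : Measurable r) :
    Measurable fun ω => τ (f ω) (r ω) := by
  obtain ⟨m, g, hg, hfg⟩ := hf
  simp only [hfg]
  exact (hτ.2 m).comp (hg.prodMk hr)

theorem measurable_profile {σ : Fin 2 → Strategy} (hσ : ∀ i, Γ.Admissible (σ i))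
    {f : Ω → History} (hf : MeasurableHistory f) {r : Ω → ℝ} (hr : Measurable r) :
    Measurable fun ω => profile σ (f ω) (r ω) :=
  measurable_pi_iff.mpr fun i => Admissible.measurable_comp Γ (hσ i) hf hr

end Measurability

theorem measurable_remaining (t : ℝ) (n : ℕ) : Measurable fun ω => remaining t ω n := by
  unfold remaining
  fun_prop

theorem measurableHistory_play {σ : Fin 2 → Strategy} (hσ : ∀ i, Γ.Admissible (σ i))
    (h : History) (t : ℝ) (n : ℕ) : MeasurableHistory fun ω => play σ h t ω n := by
  induction n with
  | zero => exact measurableHistory_const h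
  | succ n ih =>
    exact ih.cons ((measurable_remaining t n).prodMk
      (Γ.measurable_profile hσ ih (measurable_remaining t n)))

open Classical in
theorem measurable_sInf_nat {Ω : Type*} [MeasurableSpace Ω] {E : ℕ → Set Ω}
    (hE : ∀ n, MeasurableSet (E n)) : Measurable fun ω => sInf {n | ω ∈ E n} := by
  -- The second alternative makes `Nat.find` return `0` when no `E n` contains `ω`, in agreement
  -- with `sInf ∅ = 0`.
  have hex : ∀ ω, ∃ n, ω ∈ E n ∨ ∀ m, ω ∉ E m := by
    intro ω
    by_cases h : ∃ n, ω ∈ E n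
    · obtain ⟨n, hn⟩ := h
      exact ⟨n, Or.inl hn⟩
    · push Not at h
      exact ⟨0, Or.inr h⟩
  have hm : Measurable fun ω => Nat.find (hex ω) := by
    refine measurable_find hex fun n => ?_
    have hset : {ω | ω ∈ E n ∨ ∀ m, ω ∉ E m} = E n ∪ ⋂ m, (E m)ᶜ := by
      ext ω; simp
    rw [hset]
    exact (hE n).union (MeasurableSet.iInter fun m => (hE m).compl)
  convert hm using 1
  ext ω
  by_cases h : ∃ n, ω ∈ E n
  · refine le_antisymm (Nat.sInf_le ?_) (Nat.find_min' _ (Or.inl (Nat.sInf_mem h)))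
    exact (Nat.find_spec (hex ω)).resolve_right fun h' => h.elim fun n hn => h' n hn
  · push Not at h
    rw [(Nat.find_eq_zero (hex ω)).mpr (Or.inr h)]
    exact Nat.sInf_eq_zero.mpr (Or.inr (eq_empty_of_forall_notMem h))

theorem measurable_lastIndex (t : ℝ) : Measurable (lastIndex t) :=
  measurable_sInf_nat (E := fun n => {ω : ℕ → ℝ | remaining t ω (n + 1) < 0}) fun n =>
    measurableSet_lt (measurable_remaining t (n + 1)) measurable_const

theorem measurable_finalProfile {σ : Fin 2 → Strategy} (hσ : ∀ i, Γ.Admissible (σ i))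
    (h : History) (t : ℝ) : Measurable (finalProfile σ h t) := by
  -- The index is random but countable, so joint measurability follows from measurability at each
  -- fixed index.
  have hZ : Measurable fun p : ℕ × (ℕ → ℝ) =>
      profile σ (play σ h t p.2 p.1) (remaining t p.2 p.1) :=
    measurable_from_prod_countable_right fun n =>
      Γ.measurable_profile hσ (Γ.measurableHistory_play hσ h t n) (measurable_remaining t n)
  exact hZ.comp ((measurable_lastIndex t).prodMk measurable_id)

/-- Nothing is known of `π` off `A × A`, so the composition passes through the subtype, where `π` is
continuous. -/
theorem measurable_payoff {Ω : Type*} [MeasurableSpace Ω] {f g : Ω → ℝ} (hf : Measurable f)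
    (hg : Measurable g) (hfA : ∀ ω, f ω ∈ Γ.A) (hgA : ∀ ω, g ω ∈ Γ.A) :
    Measurable fun ω => Γ.π (f ω) (g ω) := by
  have hc : Continuous ((Γ.A ×ˢ Γ.A).domRestrict (Function.uncurry Γ.π)) :=
    continuousOn_iff_continuous_domRestrict.mp Γ.continuousOn_π
  exact hc.measurable.comp ((hf.prodMk hg).subtype_mk (h := fun ω => ⟨hfA ω, hgA ω⟩))

theorem measurable_realizedPayoff {σ : Fin 2 → Strategy} (hσ : ∀ i, Γ.Admissible (σ i))
    (h : History) (t : ℝ) (i : Fin 2) : Measurable (Γ.realizedPayoff σ h t i) := by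
  have hm := Γ.measurable_finalProfile hσ h t
  exact Γ.measurable_payoff ((measurable_pi_apply i).comp hm) ((measurable_pi_apply i.rev).comp hm)
    (fun ω => (hσ i).1 _ _) (fun ω => (hσ i.rev).1 _ _)

/-! ### Dynamic programming -/

/-- A bounded function of the state of a subgame that is a sub-solution of the dynamic programming
equation with terminal reward `ψ` is a lower bound for the expected terminal reward. -/
theorem le_lintegral_finalProfile {σ : Fin 2 → Strategy} {ψ : (Fin 2 → ℝ) → ENNReal}
    (hψ : ∀ h t, Measurable fun ω => ψ (finalProfile σ h t ω))
    {W : History → ℝ → ENNReal} {B : ENNReal} (hB : B ≠ ⊤) (hWB : ∀ h t, 0 ≤ t → W h t ≤ B)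
    (hW : ∀ h t, 0 ≤ t → W h t ≤ ψ (profile σ h t) * Γ.waitLaw (Ioi t) +
      ∫⁻ w in Icc 0 t, W ((t, profile σ h t) :: h) (t - w) ∂Γ.waitLaw)
    (h : History) {t : ℝ} (ht : 0 ≤ t) :
    W h t ≤ ∫⁻ ω, ψ (finalProfile σ h t ω) ∂Γ.arrivalLaw := by
  set R : History → ℝ → ENNReal := fun h t => ∫⁻ ω, ψ (finalProfile σ h t ω) ∂Γ.arrivalLaw with hR
  have hRrec : ∀ h t, 0 ≤ t → ψ (profile σ h t) * Γ.waitLaw (Ioi t) +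
      ∫⁻ w in Icc 0 t, R ((t, profile σ h t) :: h) (t - w) ∂Γ.waitLaw ≤ R h t := by
    intro h t ht
    have e : R h t = _ := Γ.lintegral_arrivalLaw (hψ h t)
    have e1 : ∫⁻ w in Ioi t, ∫⁻ ω, ψ (finalProfile σ h t (consSeq (w, ω)))
        ∂Γ.arrivalLaw ∂Γ.waitLaw = ψ (profile σ h t) * Γ.waitLaw (Ioi t) := by
      rw [← setLIntegral_const]
      refine setLIntegral_congr_fun measurableSet_Ioi fun w hw => ?_
      simp only [finalProfile_consSeq_of_lt σ h hw]
      simp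
    have e2 : ∫⁻ w in Icc 0 t, ∫⁻ ω, ψ (finalProfile σ h t (consSeq (w, ω)))
        ∂Γ.arrivalLaw ∂Γ.waitLaw =
        ∫⁻ w in Icc 0 t, R ((t, profile σ h t) :: h) (t - w) ∂Γ.waitLaw := by
      refine setLIntegral_congr_fun measurableSet_Icc fun w hw => ?_
      refine lintegral_congr_ae ?_
      filter_upwards [Γ.ae_exists_remaining_neg (sub_nonneg.mpr hw.2)] with ω hω
      rw [finalProfile_consSeq_of_le σ h hw.2 hω]
    have hdisj : Disjoint (Ioi t) (Icc 0 t) :=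
      disjoint_left.mpr fun x hx hx' => absurd hx'.2 (not_le.mpr hx)
    rw [e, ← e1, ← e2, ← lintegral_union measurableSet_Icc hdisj]
    exact setLIntegral_le_lintegral _ _
  set q := Γ.waitLaw (Icc 0 t) with hq
  have hq1 : q < 1 := by
    rw [hq, Γ.waitLaw_Icc_zero ht, ENNReal.ofReal_lt_one]
    linarith [Real.exp_pos (-(Γ.lam * t))]
  -- Each iteration replaces `W` by `R` up to an error multiplied by the probability of another
  -- opportunity, at most `q` for all `s ≤ t`. Only the constant error term needs to be measurable
  -- in `w`.
  have key : ∀ n : ℕ, ∀ (h : History) (s : ℝ), 0 ≤ s → s ≤ t → W h s ≤ R h s + B * q ^ n := by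
    intro n
    induction n with
    | zero =>
      intro h s hs _
      simpa using (hWB h s hs).trans le_add_self
    | succ n ih =>
      intro h s hs hst
      calc W h s ≤ ψ (profile σ h s) * Γ.waitLaw (Ioi s) +
            ∫⁻ w in Icc 0 s, W ((s, profile σ h s) :: h) (s - w) ∂Γ.waitLaw := hW h s hs
        _ ≤ ψ (profile σ h s) * Γ.waitLaw (Ioi s) +
            ∫⁻ w in Icc 0 s, (R ((s, profile σ h s) :: h) (s - w) + B * q ^ n) ∂Γ.waitLaw := by
          refine add_le_add le_rfl (setLIntegral_mono' measurableSet_Icc fun w hw => ?_)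
          exact ih _ _ (by linarith [hw.2]) (by linarith [hw.1])
        _ = ψ (profile σ h s) * Γ.waitLaw (Ioi s) +
            ∫⁻ w in Icc 0 s, R ((s, profile σ h s) :: h) (s - w) ∂Γ.waitLaw +
            B * q ^ n * Γ.waitLaw (Icc 0 s) := by
          rw [lintegral_add_right _ measurable_const, setLIntegral_const, add_assoc]
        _ ≤ R h s + B * q ^ (n + 1) := by
          rw [pow_succ, ← mul_assoc]
          refine add_le_add (hRrec h s hs) ?_
          gcongr
          exact measure_mono (Icc_subset_Icc_right hst)
  have h0 := (ENNReal.Tendsto.const_mul (a := B)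
    (ENNReal.tendsto_pow_atTop_nhds_zero_of_lt_one hq1) (Or.inr hB))
  have h1 := h0.const_add (R h t)
  rw [mul_zero, add_zero] at h1
  exact ge_of_tendsto' h1 fun n => key n h t ht le_rfl

/-! ### Retaliation phases -/

section Retaliation

variable {x : ℝ → ℝ} {k : ℝ}

/-- `InRetaliation` tests only the lower end of a phase, so it passes to larger remaining times.
Hence a state outside retaliation stays outside as time runs down, until a new deviation. -/
theorem InRetaliation.mono {h : History} {s t : ℝ} (hst : s ≤ t) (hs : InRetaliation x k h s) :
    InRetaliation x k h t := by
  induction h with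
  | nil => exact hs
  | cons e h ih =>
    rcases hs with ⟨h1, h2⟩ | ⟨h1, h2, h3⟩
    · exact Or.inl ⟨h1, ih h2⟩
    · exact Or.inr ⟨h1, h2, h3.trans hst⟩

theorem measurableSet_inRetaliation {Ω : Type*} [MeasurableSpace Ω] (hx : Measurable x) :
    ∀ {n : ℕ} {g : Ω → Fin n → ℝ × (Fin 2 → ℝ)} {r : Ω → ℝ}, Measurable g → Measurable r →
      MeasurableSet {ω | InRetaliation x k (List.ofFn (g ω)) (r ω)} := by
  intro n
  induction n with
  | zero => intro g r _ _; simp [InRetaliation]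
  | succ n ih =>
    intro g r hg hr
    have h0 : Measurable fun ω => g ω 0 := (measurable_pi_apply 0).comp hg
    have hs : Measurable fun ω => fun j : Fin n => g ω j.succ :=
      measurable_pi_iff.mpr fun j => (measurable_pi_apply j.succ).comp hg
    simp only [List.ofFn_succ, InRetaliation]
    have m1 := ih hs h0.fst
    have m2 := ih hs hr
    have m3 : MeasurableSet {ω | ∃ i, (g ω 0).2 i ≠ x (g ω 0).1} := by
      simp only [ofPred_exists]
      refine MeasurableSet.iUnion fun i => MeasurableSet.compl ?_
      exact measurableSet_eq_fun ((measurable_pi_apply i).comp h0.snd) (hx.comp h0.fst)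
    have m4 : MeasurableSet {ω | (g ω 0).1 - k * (g ω 0).1 ≤ r ω} :=
      measurableSet_le (h0.fst.sub (h0.fst.const_mul k)) hr
    exact (m1.inter m2).union (m1.compl.inter (m3.inter m4))

end Retaliation

/-! ### Stage-game gains and losses -/

theorem uIcc_subset_A : uIcc Γ.aN Γ.aStar ⊆ Γ.A :=
  Γ.convex_A.ordConnected.uIcc_subset Γ.aN_mem Γ.aStar_mem

theorem loss_le_loss {b c : ℝ} (hb : b ∈ uIcc Γ.aN Γ.aStar) (hc : c ∈ uIcc Γ.aN b) :
    Γ.loss c ≤ Γ.loss b := by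
  unfold loss
  refine sub_le_sub_right ?_ _
  rcases lt_trichotomy Γ.aN Γ.aStar with h | h | h
  · rw [uIcc_of_le h.le] at hb
    rw [uIcc_of_le hb.1] at hc
    exact (Γ.strictMono_diag h).monotoneOn ⟨hc.1, hc.2.trans hb.2⟩ hb hc.2
  · rw [← h, uIcc_self, mem_singleton_iff] at hb
    rw [hb, uIcc_self, mem_singleton_iff] at hc
    rw [hb, hc]
  · rw [uIcc_of_ge h.le] at hb
    rw [uIcc_of_ge hb.2] at hc
    exact (Γ.strictAnti_diag h).antitoneOn hb ⟨hb.1.trans hc.1, hc.2⟩ hc.1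

theorem loss_nonneg {b : ℝ} (hb : b ∈ uIcc Γ.aN Γ.aStar) : 0 ≤ Γ.loss b := by
  have h := Γ.loss_le_loss hb left_mem_uIcc
  rwa [loss, sub_self] at h

theorem loss_le_loss_aStar {b : ℝ} (hb : b ∈ Γ.A) : Γ.loss b ≤ Γ.loss Γ.aStar :=
  sub_le_sub_right (Γ.optimal b hb) _

theorem sub_le_gain {a b : ℝ} (ha : a ∈ Γ.A) (hb : b ∈ Γ.A) : Γ.π a b - Γ.π b b ≤ Γ.gain b := by
  obtain ⟨c, -, hc⟩ := Γ.exists_best_reply b hb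
  refine sub_le_sub_right (le_csSup (s := (fun a' => Γ.π a' b) '' Γ.A) ⟨Γ.π c b, ?_⟩
    ⟨a, ha, rfl⟩) _
  rintro _ ⟨a', ha', rfl⟩
  exact hc a' ha'

theorem gain_nonneg {b : ℝ} (hb : b ∈ Γ.A) : 0 ≤ Γ.gain b := by
  simpa using Γ.sub_le_gain hb hb

/-! ### The piecewise constant plan and its deterrent -/

section Plan

variable {k : ℝ} {a : ℕ → ℝ}

theorem one_le_slot (k t : ℝ) : 1 ≤ Γ.slot k t := le_max_left _ _

theorem exists_pow_mul_T_le (hk : k ∈ Ioo (0 : ℝ) 1) {t : ℝ} (ht : 0 < t) :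
    ∃ n : ℕ, (1 - k) ^ n * Γ.T ≤ t := by
  obtain ⟨n, hn⟩ := exists_pow_lt_of_lt_one (div_pos ht Γ.T_pos) (by linarith [hk.1] : 1 - k < 1)
  exact ⟨n, ((lt_div_iff₀ Γ.T_pos).mp hn).le⟩

theorem pow_slot_mul_T_le (hk : k ∈ Ioo (0 : ℝ) 1) {t : ℝ} (ht : 0 < t) :
    (1 - k) ^ Γ.slot k t * Γ.T ≤ t := by
  have h : (1 - k) ^ sInf {n : ℕ | (1 - k) ^ n * Γ.T ≤ t} * Γ.T ≤ t :=
    Nat.sInf_mem (Γ.exists_pow_mul_T_le hk ht)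
  refine le_trans ?_ h
  refine mul_le_mul_of_nonneg_right ?_ Γ.T_pos.le
  exact pow_le_pow_of_le_one (by linarith [hk.2]) (by linarith [hk.1]) (le_max_right _ _)

theorem slot_le {t : ℝ} {n : ℕ} (hn : 1 ≤ n)
    (h : (1 - k) ^ n * Γ.T ≤ t) : Γ.slot k t ≤ n :=
  max_le hn (Nat.sInf_le h)

theorem slot_antitone (hk : k ∈ Ioo (0 : ℝ) 1) {s t : ℝ} (hs : 0 < s) (hst : s ≤ t) :
    Γ.slot k t ≤ Γ.slot k s :=
  Γ.slot_le (Γ.one_le_slot k s) ((Γ.pow_slot_mul_T_le hk hs).trans hst)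

theorem pcPlan_of_nonpos {t : ℝ} (ht : t ≤ 0) : Γ.pcPlan k a t = Γ.aN := if_pos ht

theorem pcPlan_of_pos {t : ℝ} (ht : 0 < t) : Γ.pcPlan k a t = a (Γ.slot k t) :=
  if_neg (not_le.mpr ht)

theorem pcPlan_mem (hmono : Γ.IsMonotoneBounded a) (t : ℝ) :
    Γ.pcPlan k a t ∈ uIcc Γ.aN Γ.aStar := by
  unfold pcPlan
  split_ifs
  exacts [left_mem_uIcc, (hmono _ (Γ.one_le_slot k t)).1]

theorem measurable_pcPlan (k : ℝ) (a : ℕ → ℝ) : Measurable (Γ.pcPlan k a) := by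
  have hs : Measurable (Γ.slot k) :=
    measurable_const.max (measurable_sInf_nat (E := fun n => {t | (1 - k) ^ n * Γ.T ≤ t})
      fun n => measurableSet_le measurable_const measurable_id)
  exact Measurable.ite (measurableSet_le measurable_id measurable_const) measurable_const
    ((measurable_from_top (f := a)).comp hs)

/-- The action set need not be compact; the recurrence itself bounds the gains uniformly in `n`,
because `τ(n+1) ≤ T` keeps its exponential factor at least `e^{-λT}`. -/
theorem gain_le (hk : k ∈ Ioo (0 : ℝ) 1) (hmono : Γ.IsMonotoneBounded a)
    (hrec : Γ.Recurrence k a) {n : ℕ} (hn : 1 ≤ n) :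
    Γ.gain (a n) ≤ Γ.loss Γ.aStar * Real.exp (Γ.lam * Γ.T) := by
  have hA := Γ.uIcc_subset_A (hmono n hn).1
  have hA' := (hmono (n + 1) (by omega)).1
  have hτ : Γ.slotLength k (n + 1) ≤ Γ.T := by
    unfold slotLength
    have h1 : (1 - k) ^ (n + 1 - 1) ≤ 1 := pow_le_one₀ (by linarith [hk.2]) (by linarith [hk.1])
    have h0 : 0 ≤ (1 - k) ^ (n + 1 - 1) := pow_nonneg (by linarith [hk.2]) _
    exact mul_le_of_le_one_left Γ.T_pos.le (by nlinarith [hk.1, hk.2])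
  have h := hrec n hn
  set E := Real.exp (-Γ.lam * Γ.slotLength k (n + 1)) with hE
  have hEpos : 0 < E := Real.exp_pos _
  have hl := Γ.loss_nonneg hA'
  have h1 : Γ.gain (a n) * E ≤ Γ.loss Γ.aStar := by
    have := Γ.loss_le_loss_aStar (Γ.uIcc_subset_A hA')
    nlinarith
  have h2 : 1 ≤ E * Real.exp (Γ.lam * Γ.T) := by
    rw [hE, ← Real.exp_add, Real.one_le_exp_iff]
    nlinarith [Γ.lam_pos]
  calc Γ.gain (a n) ≤ Γ.gain (a n) * (E * Real.exp (Γ.lam * Γ.T)) :=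
        le_mul_of_one_le_right (Γ.gain_nonneg hA) h2
    _ = Γ.gain (a n) * E * Real.exp (Γ.lam * Γ.T) := by ring
    _ ≤ _ := mul_le_mul_of_nonneg_right h1 (Real.exp_pos _).le

/-- A single deviation is deterred by the retaliation phase that follows it. -/
theorem exists_deterrent (hk : k ∈ Ioo (0 : ℝ) 1) (hmono : Γ.IsMonotoneBounded a)
    (hrec : Γ.Recurrence k a) {t : ℝ} (ht : 0 ≤ t) :
    ∃ l, 0 ≤ l ∧ (∀ s, t - k * t ≤ s → s ≤ t → l ≤ Γ.loss (Γ.pcPlan k a s)) ∧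
      ∀ b ∈ Γ.A, (Γ.π b (Γ.pcPlan k a t) - Γ.π (Γ.pcPlan k a t) (Γ.pcPlan k a t)) *
          Real.exp (-(Γ.lam * t)) ≤
        l * (Real.exp (-(Γ.lam * (t - k * t))) - Real.exp (-(Γ.lam * t))) := by
  rcases ht.eq_or_lt with rfl | ht
  -- At the deadline no punishment is possible, but the plan prescribes the Nash action, so `l = 0`
  -- suffices.
  · refine ⟨0, le_rfl, fun s _ _ => Γ.loss_nonneg (Γ.pcPlan_mem hmono s), fun b hb => ?_⟩
    rw [Γ.pcPlan_of_nonpos le_rfl, zero_mul]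
    exact mul_nonpos_of_nonpos_of_nonneg (sub_nonpos.mpr (Γ.nash b hb)) (Real.exp_pos _).le
  set n := Γ.slot k t with hn
  have hn1 : 1 ≤ n := Γ.one_le_slot k t
  have hnt : (1 - k) ^ n * Γ.T ≤ t := Γ.pow_slot_mul_T_le hk ht
  have hmem := (hmono n hn1).1
  have hmem' := (hmono (n + 1) (by omega)).1
  have hl := Γ.loss_nonneg hmem'
  -- The phase starts in slot `n` and, as `(1-k)t ≥ (1-k)^(n+1) T`, ends no later than slot `n+1`;
  -- the smaller of the two losses is that of `a (n+1)`.
  refine ⟨Γ.loss (a (n + 1)), hl, fun s hs hst => ?_, fun b hb => ?_⟩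
  · have hs0 : 0 < s := by nlinarith [hk.2]
    have h1 : n ≤ Γ.slot k s := Γ.slot_antitone hk hs0 hst
    have h2 : Γ.slot k s ≤ n + 1 := by
      refine Γ.slot_le (by omega) (le_trans ?_ hs)
      rw [pow_succ]
      nlinarith [hk.2]
    rw [Γ.pcPlan_of_pos hs0]
    rcases Nat.le_succ_iff.mp h2 with h3 | h3
    · rw [le_antisymm h3 h1]
      exact Γ.loss_le_loss hmem (hmono n hn1).2
    · rw [h3]
  · rw [Γ.pcPlan_of_pos ht, ← hn]
    have hg := Γ.sub_le_gain hb (Γ.uIcc_subset_A hmem)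
    have hg0 := Γ.gain_nonneg (Γ.uIcc_subset_A hmem)
    have hr := hrec n hn1
    set E₀ := Real.exp (-Γ.lam * Γ.slotLength k (n + 1)) with hE₀
    -- The phase has length `kt ≥ k(1-k)^n T = τ(n+1)`; a longer phase only strengthens the
    -- recurrence inequality.
    have hE : Real.exp (-(Γ.lam * (k * t))) ≤ E₀ := by
      rw [hE₀, Real.exp_le_exp, neg_mul, neg_le_neg_iff]
      refine mul_le_mul_of_nonneg_left ?_ Γ.lam_pos.le
      rw [slotLength, Nat.add_sub_cancel, mul_assoc]
      exact mul_le_mul_of_nonneg_left hnt hk.1.le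
    set E := Real.exp (-(Γ.lam * (k * t))) with hEdef
    -- Dividing by the probability of no opportunity after the phase leaves an inequality in its
    -- length `kt` alone.
    have hEE : Real.exp (-(Γ.lam * t)) = Real.exp (-(Γ.lam * (t - k * t))) * E := by
      rw [hEdef, ← Real.exp_add]; ring_nf
    have hEpos : 0 < E := Real.exp_pos _
    have h1 : (Γ.π b (a n) - Γ.π (a n) (a n)) * E ≤ Γ.loss (a (n + 1)) * (1 - E) :=
      calc _ ≤ Γ.gain (a n) * E := mul_le_mul_of_nonneg_right hg hEpos.le
        _ ≤ Γ.gain (a n) * E₀ := mul_le_mul_of_nonneg_left hE hg0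
        _ ≤ Γ.loss (a (n + 1)) * (1 - E₀) := hr
        _ ≤ _ := mul_le_mul_of_nonneg_left (by linarith) hl
    rw [hEE]
    have h2 := mul_le_mul_of_nonneg_left h1 (Real.exp_pos (-(Γ.lam * (t - k * t)))).le
    linarith

end Plan

/-! ### Continuation play under limited retaliation -/

section LimitedRetaliation

variable {x : ℝ → ℝ} {k : ℝ}

theorem lrStrategy_of_inRetaliation {h : History} {t : ℝ} (hr : InRetaliation x k h t) :
    Γ.lrStrategy x k h t = Γ.aN := if_pos hr

theorem lrStrategy_of_not_inRetaliation {h : History} {t : ℝ} (hr : ¬ InRetaliation x k h t) :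
    Γ.lrStrategy x k h t = x t := if_neg hr

theorem lrStrategy_mem (hx : ∀ t, x t ∈ uIcc Γ.aN Γ.aStar) (h : History) (t : ℝ) :
    Γ.lrStrategy x k h t ∈ uIcc Γ.aN Γ.aStar := by
  unfold lrStrategy
  split_ifs
  exacts [left_mem_uIcc, hx t]

theorem admissible_lrStrategy (hx : ∀ t, x t ∈ uIcc Γ.aN Γ.aStar) (hxm : Measurable x) :
    Γ.Admissible (Γ.lrStrategy x k) := by
  classical
  refine ⟨fun h t => Γ.uIcc_subset_A (Γ.lrStrategy_mem hx h t), fun n => ?_⟩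
  exact Measurable.ite (measurableSet_inRetaliation hxm measurable_fst measurable_snd)
    measurable_const (hxm.comp measurable_snd)

theorem measurable_lrStrategy (hx : ∀ t, x t ∈ uIcc Γ.aN Γ.aStar) (hxm : Measurable x)
    (h : History) : Measurable (Γ.lrStrategy x k h) :=
  Admissible.measurable_comp Γ (Γ.admissible_lrStrategy hx hxm) (measurableHistory_const h)
    measurable_id

open Classical in
/-- Actions that conform to the plan, or that are taken during a retaliation phase, do not
influence future play. -/
theorem lrStrategy_cons_of_conform {h : History} {s t : ℝ} (hst : s ≤ t) {p : Fin 2 → ℝ}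
    (hp : InRetaliation x k h t ∨ ∀ i, p i = x t) :
    Γ.lrStrategy x k ((t, p) :: h) s = Γ.lrStrategy x k h s := by
  have : InRetaliation x k ((t, p) :: h) s ↔ InRetaliation x k h s := by
    simp only [InRetaliation]
    by_cases hr : InRetaliation x k h t
    · simp [hr]
    · have hp' := hp.resolve_left hr
      have hs : ¬ InRetaliation x k h s := fun hs => hr (hs.mono hst)
      simp [hr, hs, hp']
  exact if_congr this rfl rfl

-- A phase inherited from `h` would have to cover `t` itself, which `hr` excludes, so only the new
-- deviation counts.
open Classical in
theorem lrStrategy_cons_of_deviate {h : History} {s t : ℝ} {p : Fin 2 → ℝ}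
    (hr : ¬ InRetaliation x k h t) (hp : ∃ i, p i ≠ x t) :
    Γ.lrStrategy x k ((t, p) :: h) s = if t - k * t ≤ s then Γ.aN else x s := by
  have : InRetaliation x k ((t, p) :: h) s ↔ t - k * t ≤ s := by
    simp only [InRetaliation]
    simp [hr, hp]
  exact if_congr this rfl rfl

/-- After conforming actions the continuation value is the one of the original state. -/
theorem setLIntegral_lrStrategy_conform {h : History} {t : ℝ} {p : Fin 2 → ℝ}
    (hp : InRetaliation x k h t ∨ ∀ i, p i = x t) (φ : ℝ → ENNReal) :
    ∫⁻ s in Icc 0 t, φ (Γ.lrStrategy x k ((t, p) :: h) s) ∂Γ.waitLaw =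
      ∫⁻ s in Icc 0 t, φ (Γ.lrStrategy x k h s) ∂Γ.waitLaw := by
  refine setLIntegral_congr_fun measurableSet_Icc fun s hs => ?_
  simp only [Γ.lrStrategy_cons_of_conform hs.2 hp]

/-- An expected reward functional of the symmetric path of play of limited retaliation that
satisfies the dynamic programming inequality at every state bounds the expected reward of the
final action profile from below. -/
theorem value_le_lintegral_finalProfile (hx : ∀ t, x t ∈ uIcc Γ.aN Γ.aStar)
    {σ : Fin 2 → Strategy} {ψ : (Fin 2 → ℝ) → ENNReal}
    (hψ : ∀ h t, Measurable fun ω => ψ (finalProfile σ h t ω))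
    {φ : ℝ → ENNReal} (hφ : ∀ h, Measurable fun s => φ (Γ.lrStrategy x k h s))
    {B : ENNReal} (hB : B ≠ ⊤) (hφB : ∀ b ∈ uIcc Γ.aN Γ.aStar, φ b ≤ B)
    (hW : ∀ h t, 0 ≤ t → Γ.value (fun s => φ (Γ.lrStrategy x k h s)) t ≤
      ψ (profile σ h t) * Γ.waitLaw (Ioi t) +
        ∫⁻ s in Icc 0 t, φ (Γ.lrStrategy x k ((t, profile σ h t) :: h) s) ∂Γ.waitLaw)
    (h : History) {t : ℝ} (ht : 0 ≤ t) :
    Γ.value (fun s => φ (Γ.lrStrategy x k h s)) t ≤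
      ∫⁻ ω, ψ (finalProfile σ h t ω) ∂Γ.arrivalLaw := by
  refine Γ.le_lintegral_finalProfile hψ
    (W := fun h t => Γ.value (fun s => φ (Γ.lrStrategy x k h s)) t)
    hB (fun h t ht => Γ.value_le (fun s => hφB _ (Γ.lrStrategy_mem hx h s)) ht) ?_ h ht
  intro h t ht
  rw [Γ.lintegral_value (hφ _)]
  exact hW h t ht

theorem measurable_comp_diag (hx : ∀ t, x t ∈ uIcc Γ.aN Γ.aStar) (hxm : Measurable x)
    (h : History) :
    Measurable fun s => Γ.π (Γ.lrStrategy x k h s) (Γ.lrStrategy x k h s) := by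
  have hm := Γ.measurable_lrStrategy (k := k) hx hxm h
  have hA := fun s => Γ.uIcc_subset_A (Γ.lrStrategy_mem (k := k) hx h s)
  exact Γ.measurable_payoff hm hm hA hA

/-- If both players use limited retaliation, the expected payoff is at least the value of the
path of play. -/
theorem value_le_lintegral_conform (hx : ∀ t, x t ∈ uIcc Γ.aN Γ.aStar) (hxm : Measurable x)
    (i : Fin 2) (h : History) {t : ℝ} (ht : 0 ≤ t) :
    Γ.value (fun s => ENNReal.ofReal (Γ.loss (Γ.lrStrategy x k h s))) t ≤
      ∫⁻ ω, ENNReal.ofReal (Γ.realizedPayoff (fun _ => Γ.lrStrategy x k) h t i ω - Γ.π Γ.aN Γ.aN)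
        ∂Γ.arrivalLaw := by
  have hadm : ∀ i : Fin 2, Γ.Admissible ((fun _ => Γ.lrStrategy x k : Fin 2 → Strategy) i) :=
    fun _ => Γ.admissible_lrStrategy hx hxm
  refine Γ.value_le_lintegral_finalProfile (B := ENNReal.ofReal (Γ.loss Γ.aStar))
    (ψ := fun p => ENNReal.ofReal (Γ.stagePayoff i p - Γ.π Γ.aN Γ.aN))
    (σ := fun _ => Γ.lrStrategy x k)
    (φ := fun b => ENNReal.ofReal (Γ.loss b)) hx
    (fun h t => ((Γ.measurable_realizedPayoff hadm h t i).sub_const _).ennreal_ofReal)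
    (fun h => ((Γ.measurable_comp_diag hx hxm h).sub_const _).ennreal_ofReal)
    ENNReal.ofReal_ne_top
    (fun b hb => ENNReal.ofReal_le_ofReal (Γ.loss_le_loss_aStar (Γ.uIcc_subset_A hb))) ?_ h ht
  intro h t _
  rw [Γ.setLIntegral_lrStrategy_conform (φ := fun b => ENNReal.ofReal (Γ.loss b))]
  · rfl
  · by_cases hr : InRetaliation x k h t
    · exact Or.inl hr
    · exact Or.inr fun i => Γ.lrStrategy_of_not_inRetaliation hr

end LimitedRetaliation

/-! ### Unprofitability of a single deviation -/

section Equilibrium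

variable {k : ℝ} {a : ℕ → ℝ}

/-- The opponent plays only `aN` or some `a n`. Against these the best reply earns at most the
diagonal payoff plus the gain, and both are bounded uniformly. -/
theorem exists_payoff_bound (hk : k ∈ Ioo (0 : ℝ) 1) (hmono : Γ.IsMonotoneBounded a)
    (hrec : Γ.Recurrence k a) :
    ∃ C, ∀ b ∈ Γ.A, ∀ h t, Γ.π b (Γ.lrStrategy (Γ.pcPlan k a) k h t) ≤ C := by
  have hpos : 0 ≤ Γ.loss Γ.aStar * Real.exp (Γ.lam * Γ.T) :=
    mul_nonneg (Γ.loss_nonneg right_mem_uIcc) (Real.exp_pos _).le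
  have hN : ∀ b ∈ Γ.A, Γ.π b Γ.aN ≤
      Γ.π Γ.aStar Γ.aStar + Γ.loss Γ.aStar * Real.exp (Γ.lam * Γ.T) := fun b hb => by
    linarith [Γ.nash b hb, Γ.optimal _ Γ.aN_mem]
  refine ⟨Γ.π Γ.aStar Γ.aStar + Γ.loss Γ.aStar * Real.exp (Γ.lam * Γ.T), fun b hb h t => ?_⟩
  unfold lrStrategy pcPlan
  split_ifs
  · exact hN b hb
  · exact hN b hb
  · have h1 := Γ.one_le_slot k t
    have hA := Γ.uIcc_subset_A (hmono _ h1).1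
    linarith [Γ.gain_le hk hmono hrec h1, Γ.sub_le_gain hb hA, Γ.optimal _ hA]

theorem waitLaw_Icc {s t : ℝ} (hs : 0 ≤ s) (hst : s ≤ t) :
    Γ.waitLaw (Icc s t) =
      ENNReal.ofReal (Real.exp (-(Γ.lam * s)) - Real.exp (-(Γ.lam * t))) := by
  have h : Icc s t = Icc 0 t \ Ico 0 s := by
    ext u
    simp only [mem_Icc, mem_sdiff, mem_Ico, not_and, not_lt]
    exact ⟨fun h => ⟨⟨hs.trans h.1, h.2⟩, fun _ => h.1⟩, fun h => ⟨h.2 h.1.1, h.1.2⟩⟩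
  have h' : Γ.waitLaw (Ico 0 s) = Γ.waitLaw (Icc 0 s) := by
    rw [← Ico_union_right hs]
    refine le_antisymm (measure_mono subset_union_left) ((measure_union_le _ _).trans ?_)
    rw [Γ.waitLaw_singleton, add_zero]
  have h1 : Real.exp (-(Γ.lam * s)) ≤ 1 := by
    rw [Real.exp_le_one_iff, neg_nonpos]; exact mul_nonneg Γ.lam_pos.le hs
  have hsub : Ico 0 s ⊆ Icc 0 t := fun u hu => ⟨hu.1, hu.2.le.trans hst⟩
  rw [h, measure_sdiff hsub measurableSet_Ico.nullMeasurableSet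
    (measure_ne_top _ _), h', Γ.waitLaw_Icc_zero hs, Γ.waitLaw_Icc_zero (hs.trans hst),
    ← ENNReal.ofReal_sub _ (by linarith)]
  congr 1
  ring

/-- The value of limited retaliation at an opportunity, net of an upper bound for the payoffs, is
at least as good as the value of any single deviation. -/
theorem value_le_deviate (hk : k ∈ Ioo (0 : ℝ) 1) (hmono : Γ.IsMonotoneBounded a)
    (hrec : Γ.Recurrence k a) {C : ℝ}
    (hC : ∀ b ∈ Γ.A, ∀ h t, Γ.π b (Γ.lrStrategy (Γ.pcPlan k a) k h t) ≤ C)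
    {h : History} {t : ℝ} (ht : 0 ≤ t) {i : Fin 2} {p : Fin 2 → ℝ} (hp : p i ∈ Γ.A)
    (hp' : p i.rev = Γ.lrStrategy (Γ.pcPlan k a) k h t) :
    Γ.value (fun s => ENNReal.ofReal (C - Γ.π (Γ.lrStrategy (Γ.pcPlan k a) k h s)
        (Γ.lrStrategy (Γ.pcPlan k a) k h s))) t ≤
      ENNReal.ofReal (C - Γ.stagePayoff i p) * Γ.waitLaw (Ioi t) +
        ∫⁻ s in Icc 0 t, ENNReal.ofReal (C - Γ.π (Γ.lrStrategy (Γ.pcPlan k a) k ((t, p) :: h) s)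
          (Γ.lrStrategy (Γ.pcPlan k a) k ((t, p) :: h) s)) ∂Γ.waitLaw := by
  set x := Γ.pcPlan k a with hxdef
  have hx : ∀ t, x t ∈ uIcc Γ.aN Γ.aStar := Γ.pcPlan_mem hmono
  have hxA : ∀ t, x t ∈ Γ.A := fun t => Γ.uIcc_subset_A (hx t)
  by_cases hr : InRetaliation x k h t
  · rw [Γ.setLIntegral_lrStrategy_conform (φ := fun b => ENNReal.ofReal (C - Γ.π b b))
      (Or.inl hr)]
    refine add_le_add (mul_le_mul_left (ENNReal.ofReal_le_ofReal ?_) _) le_rfl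
    rw [Γ.lrStrategy_of_inRetaliation hr] at hp'
    rw [Γ.lrStrategy_of_inRetaliation hr, stagePayoff, hp']
    exact sub_le_sub_left (Γ.nash _ hp) _
  rw [Γ.lrStrategy_of_not_inRetaliation hr] at hp'
  by_cases hpi : p i = x t
  · have hall : ∀ j, p j = x t := by
      intro j
      have : j = i ∨ j = i.rev := by
        clear hpi hp hp'
        revert i j
        decide
      rcases this with rfl | rfl
      exacts [hpi, hp']
    rw [Γ.setLIntegral_lrStrategy_conform (φ := fun b => ENNReal.ofReal (C - Γ.π b b))
      (Or.inr hall), value, Γ.lrStrategy_of_not_inRetaliation hr, stagePayoff, hpi, hp']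
  obtain ⟨l, hl0, hl, hdet⟩ := Γ.exists_deterrent hk hmono hrec ht
  rw [← hxdef] at hl hdet
  have hkt : 0 ≤ t - k * t := by nlinarith [hk.2]
  have hkt' : t - k * t ≤ t := by nlinarith [hk.1]
  -- A history consisting of this deviation alone makes the opponent play `aN`, so `C` also bounds
  -- payoffs against `aN`.
  have hCN : ∀ b ∈ Γ.A, Γ.π b Γ.aN ≤ C := fun b hb => by
    have := hC b hb [(t, p)] (t - k * t)
    rwa [Γ.lrStrategy_cons_of_deviate (h := []) (by simp [InRetaliation]) ⟨i, hpi⟩,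
      if_pos le_rfl] at this
  have hCx : ∀ b ∈ Γ.A, ∀ s, Γ.π b (x s) ≤ C := fun b hb s => by
    have := hC b hb [] s
    rwa [Γ.lrStrategy_of_not_inRetaliation (by simp [InRetaliation])] at this
  -- The final time is split at the end of the phase: below it both continuations follow the plan,
  -- above it one plays `aN` and the other loses at least `l` less.
  have hdisj : Disjoint (Ico 0 (t - k * t)) (Icc (t - k * t) t) :=
    disjoint_left.mpr fun u hu hu' => absurd hu'.1 (not_le.mpr hu.2)
  have hunion : Icc 0 t = Ico 0 (t - k * t) ∪ Icc (t - k * t) t :=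
    (Ico_union_Icc_eq_Icc hkt hkt').symm
  have hlr : ∀ s ≤ t, Γ.lrStrategy x k h s = x s := fun s hs =>
    Γ.lrStrategy_of_not_inRetaliation fun hs' => hr (hs'.mono hs)
  have hCNl : l ≤ C - Γ.π Γ.aN Γ.aN := by
    have h1 := hl t hkt' le_rfl
    have h2 := hCx (x t) (hxA t) t
    unfold loss at h1
    linarith
  have hexp : Real.exp (-(Γ.lam * t)) ≤ Real.exp (-(Γ.lam * (t - k * t))) := by
    rw [Real.exp_le_exp, neg_le_neg_iff]
    exact mul_le_mul_of_nonneg_left hkt' Γ.lam_pos.le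
  rw [value, hunion, lintegral_union measurableSet_Icc hdisj,
    lintegral_union measurableSet_Icc hdisj, hlr t le_rfl, stagePayoff, hp']
  have e1 : ∫⁻ s in Ico 0 (t - k * t), ENNReal.ofReal (C - Γ.π (Γ.lrStrategy x k ((t, p) :: h) s)
        (Γ.lrStrategy x k ((t, p) :: h) s)) ∂Γ.waitLaw =
      ∫⁻ s in Ico 0 (t - k * t), ENNReal.ofReal (C - Γ.π (Γ.lrStrategy x k h s)
        (Γ.lrStrategy x k h s)) ∂Γ.waitLaw := by
    refine setLIntegral_congr_fun measurableSet_Ico fun s hs => ?_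
    simp only [Γ.lrStrategy_cons_of_deviate hr ⟨i, hpi⟩, if_neg (not_le.mpr hs.2),
      hlr s (hs.2.le.trans hkt')]
  have e2 : ∫⁻ s in Icc (t - k * t) t, ENNReal.ofReal (C - Γ.π
        (Γ.lrStrategy x k ((t, p) :: h) s) (Γ.lrStrategy x k ((t, p) :: h) s)) ∂Γ.waitLaw =
      ENNReal.ofReal (C - Γ.π Γ.aN Γ.aN) * Γ.waitLaw (Icc (t - k * t) t) := by
    rw [← setLIntegral_const]
    refine setLIntegral_congr_fun measurableSet_Icc fun s hs => ?_
    simp only [Γ.lrStrategy_cons_of_deviate hr ⟨i, hpi⟩, if_pos hs.1]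
  have e3 : ∫⁻ s in Icc (t - k * t) t, ENNReal.ofReal (C - Γ.π
        (Γ.lrStrategy x k h s) (Γ.lrStrategy x k h s)) ∂Γ.waitLaw ≤
      ENNReal.ofReal (C - Γ.π Γ.aN Γ.aN - l) * Γ.waitLaw (Icc (t - k * t) t) := by
    rw [← setLIntegral_const]
    refine setLIntegral_mono' measurableSet_Icc fun s hs => ENNReal.ofReal_le_ofReal ?_
    rw [hlr s hs.2]
    have := hl s hs.1 hs.2
    unfold loss at this
    linarith
  -- With the common part below the phase removed, this is the deterrent inequality shifted by `C`;
  -- nonnegativity of all terms lets `ofReal` be taken outside.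
  have key : ENNReal.ofReal (C - Γ.π (x t) (x t)) * Γ.waitLaw (Ioi t) +
      ENNReal.ofReal (C - Γ.π Γ.aN Γ.aN - l) * Γ.waitLaw (Icc (t - k * t) t) ≤
      ENNReal.ofReal (C - Γ.π (p i) (x t)) * Γ.waitLaw (Ioi t) +
      ENNReal.ofReal (C - Γ.π Γ.aN Γ.aN) * Γ.waitLaw (Icc (t - k * t) t) := by
    have hd := hdet (p i) hp
    have n1 : 0 ≤ C - Γ.π (x t) (x t) := sub_nonneg.mpr (hCx _ (hxA t) t)
    have n2 : 0 ≤ C - Γ.π (p i) (x t) := sub_nonneg.mpr (hCx _ hp t)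
    have n3 : 0 ≤ C - Γ.π Γ.aN Γ.aN := sub_nonneg.mpr (hCN _ Γ.aN_mem)
    have n4 : 0 ≤ C - Γ.π Γ.aN Γ.aN - l := sub_nonneg.mpr hCNl
    have n5 := (Real.exp_pos (-(Γ.lam * t))).le
    have n6 := sub_nonneg.mpr hexp
    rw [Γ.waitLaw_Ioi ht, Γ.waitLaw_Icc hkt hkt', ← ENNReal.ofReal_mul n1, ← ENNReal.ofReal_mul n2,
      ← ENNReal.ofReal_mul n3, ← ENNReal.ofReal_mul n4,
      ← ENNReal.ofReal_add (mul_nonneg n1 n5) (mul_nonneg n4 n6),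
      ← ENNReal.ofReal_add (mul_nonneg n2 n5) (mul_nonneg n3 n6)]
    refine ENNReal.ofReal_le_ofReal ?_
    linarith
  rw [e1, e2, add_left_comm, add_left_comm (ENNReal.ofReal _ * _)]
  exact add_le_add le_rfl ((add_le_add le_rfl e3).trans key)

end Equilibrium

/-! ### Comparison of extended expectations -/

/-- Comparison of extended expectations through a common bound. -/
theorem lintegral_sub_le_of_le_add {Ω : Type*} [MeasurableSpace Ω] {P : Measure Ω}
    [IsProbabilityMeasure P] {X Y : Ω → ℝ} (hX : Measurable X) {C m : ℝ} (hXC : ∀ ω, X ω ≤ C)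
    (hY : Integrable Y P) (hYm : ∀ ω, m ≤ Y ω)
    (h : ENNReal.ofReal (C - m) ≤ ∫⁻ ω, ENNReal.ofReal (C - X ω) ∂P +
      ∫⁻ ω, ENNReal.ofReal (Y ω - m) ∂P) :
    ((∫⁻ ω, ENNReal.ofReal (X ω) ∂P : ENNReal) : EReal) -
        ((∫⁻ ω, ENNReal.ofReal (-X ω) ∂P : ENNReal) : EReal) ≤
      ((∫⁻ ω, ENNReal.ofReal (Y ω) ∂P : ENNReal) : EReal) -
        ((∫⁻ ω, ENNReal.ofReal (-Y ω) ∂P : ENNReal) : EReal) := by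
  have hreal : ∀ {Z : Ω → ℝ}, Integrable Z P →
      ((∫⁻ ω, ENNReal.ofReal (Z ω) ∂P : ENNReal) : EReal) -
        ((∫⁻ ω, ENNReal.ofReal (-Z ω) ∂P : ENNReal) : EReal) = ((∫ ω, Z ω ∂P : ℝ) : EReal) := by
    intro Z hZ
    rw [integral_eq_lintegral_pos_part_sub_lintegral_neg_part hZ, EReal.coe_sub,
      EReal.coe_ennreal_toReal hZ.lintegral_lt_top.ne,
      EReal.coe_ennreal_toReal (x := ∫⁻ ω, ENNReal.ofReal (-Z ω) ∂P)
        hZ.neg.lintegral_lt_top.ne]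
  -- An infinite negative part makes the left side `⊥`, since subtracting `⊤` in `EReal` always
  -- gives `⊥`. Otherwise the upper bound `C` makes `X` integrable.
  by_cases htop : ∫⁻ ω, ENNReal.ofReal (-X ω) ∂P = ⊤
  · have : ((∫⁻ ω, ENNReal.ofReal (X ω) ∂P : ENNReal) : EReal) -
        ((∫⁻ ω, ENNReal.ofReal (-X ω) ∂P : ENNReal) : EReal) = ⊥ := by
      rw [htop, EReal.coe_ennreal_top, EReal.sub_top]
    rw [this]
    exact bot_le
  have hXi : Integrable X P := by
    have h1 : Integrable (fun ω => max (X ω) 0) P :=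
      Integrable.of_bound (hX.max measurable_const).aestronglyMeasurable (max C 0)
        (Filter.Eventually.of_forall fun ω => by
          rw [Real.norm_of_nonneg (le_max_right _ _)]
          exact max_le_max_right _ (hXC ω))
    have h2 : Integrable (fun ω => max (-X ω) 0) P := by
      refine ⟨(hX.neg.max measurable_const).aestronglyMeasurable, ?_⟩
      rw [hasFiniteIntegral_iff_ofReal (f := fun ω => max (-X ω) 0)
        (Filter.Eventually.of_forall fun ω => le_max_right _ _)]
      simpa [ENNReal.ofReal_max] using lt_top_iff_ne_top.mpr htop
    refine (h1.sub h2).congr (Filter.Eventually.of_forall fun ω => ?_)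
    simp only [Pi.sub_apply]
    rcases le_total (X ω) 0 with h0 | h0
    · rw [max_eq_right h0, max_eq_left (by linarith)]; ring
    · rw [max_eq_left h0, max_eq_right (by linarith)]; ring
  rw [hreal hXi, hreal hY, EReal.coe_le_coe_iff]
  have i1 : Integrable (fun ω => C - X ω) P := (integrable_const C).sub hXi
  have i2 : Integrable (fun ω => Y ω - m) P := hY.sub (integrable_const m)
  have n1 : 0 ≤ ∫ ω, (C - X ω) ∂P := integral_nonneg fun ω => sub_nonneg.mpr (hXC ω)
  have n2 : 0 ≤ ∫ ω, (Y ω - m) ∂P := integral_nonneg fun ω => sub_nonneg.mpr (hYm ω)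
  rw [← ofReal_integral_eq_lintegral_ofReal i1
      (Filter.Eventually.of_forall fun ω => sub_nonneg.mpr (hXC ω)),
    ← ofReal_integral_eq_lintegral_ofReal i2
      (Filter.Eventually.of_forall fun ω => sub_nonneg.mpr (hYm ω)),
    ← ENNReal.ofReal_add n1 n2, ENNReal.ofReal_le_ofReal_iff (add_nonneg n1 n2),
    integral_sub (integrable_const C) hXi, integral_sub hY (integrable_const m)] at h
  simp at h
  linarith

end RevisionGame

/-! ### The equilibrium property -/

theorem corollary1 (Γ : RevisionGame) (k : ℝ) (hk : k ∈ Set.Ioo (0 : ℝ) 1) (ε : ℝ) (hε : 0 ≤ ε)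
    (a : ℕ → ℝ) (hmono : Γ.IsMonotoneBounded a) (hrec : Γ.Recurrence k a)
    (hterm : Γ.ApproxTerminal ε k a) :
    Γ.IsApproxSPE ε (fun _ => Γ.lrStrategy (Γ.pcPlan k a) k) := by
  set x := Γ.pcPlan k a with hxdef
  have hx : ∀ t, x t ∈ uIcc Γ.aN Γ.aStar := Γ.pcPlan_mem hmono
  have hxm : Measurable x := Γ.measurable_pcPlan k a
  have hadm : Γ.Admissible (Γ.lrStrategy x k) := Γ.admissible_lrStrategy hx hxm
  obtain ⟨C, hC⟩ := Γ.exists_payoff_bound hk hmono hrec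
  refine ⟨fun _ => hadm, fun h t _ ht i => ?_⟩
  -- Both players take the same action after every history, so the payoff lies on the diagonal,
  -- where it is at least the Nash payoff.
  have hlow : ∀ ω, Γ.π Γ.aN Γ.aN ≤ Γ.realizedPayoff (fun _ => Γ.lrStrategy x k) h t i ω :=
    fun ω => sub_nonneg.mp (Γ.loss_nonneg (Γ.lrStrategy_mem (k := k) hx _ _))
  have hup : ∀ ω, Γ.realizedPayoff (fun _ => Γ.lrStrategy x k) h t i ω ≤ C :=
    fun ω => hC _ (hadm.1 _ _) _ _
  have hint : Integrable (Γ.realizedPayoff (fun _ => Γ.lrStrategy x k) h t i) Γ.arrivalLaw :=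
    Integrable.of_mem_Icc _ _ (Γ.measurable_realizedPayoff (fun _ => hadm) h t i).aemeasurable
      (Filter.Eventually.of_forall fun ω => ⟨hlow ω, hup ω⟩)
  refine ⟨hint, fun τ hτ => ?_⟩
  have hrev : i.rev ≠ i := by
    clear hlow hup hint
    revert i
    decide
  set σ : Fin 2 → Strategy := Function.update (fun _ => Γ.lrStrategy x k) i τ with hσ
  have hσi : σ i = τ := Function.update_self ..
  have hσr : σ i.rev = Γ.lrStrategy x k := Function.update_of_ne hrev ..
  have hσadm : ∀ j, Γ.Admissible (σ j) := fun j => by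
    by_cases hj : j = i
    · rw [hj, hσi]; exact hτ
    · rw [hσ, Function.update_of_ne hj]; exact hadm
  have hdevC : ∀ ω, Γ.realizedPayoff σ h t i ω ≤ C := fun ω => by
    simp only [RevisionGame.realizedPayoff, RevisionGame.stagePayoff]
    rw [hσr]
    exact hC _ ((hσadm i).1 _ _) _ _
  have hCN : Γ.π Γ.aN Γ.aN ≤ C := (hlow 0).trans (hup 0)
  have hdiag : ∀ h s, Γ.π (Γ.lrStrategy x k h s) (Γ.lrStrategy x k h s) ≤ C :=
    fun h s => hC _ (hadm.1 h s) h s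
  have hdev : Γ.value (fun s => ENNReal.ofReal
      (C - Γ.π (Γ.lrStrategy x k h s) (Γ.lrStrategy x k h s))) t ≤
      ∫⁻ ω, ENNReal.ofReal (C - Γ.realizedPayoff σ h t i ω) ∂Γ.arrivalLaw := by
    refine Γ.value_le_lintegral_finalProfile (B := ENNReal.ofReal (C - Γ.π Γ.aN Γ.aN))
      (ψ := fun p => ENNReal.ofReal (C - Γ.stagePayoff i p))
      (φ := fun b => ENNReal.ofReal (C - Γ.π b b)) hx
      (fun h t => ((Γ.measurable_realizedPayoff hσadm h t i).const_sub _).ennreal_ofReal)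
      (fun h => ((Γ.measurable_comp_diag hx hxm h).const_sub _).ennreal_ofReal)
      ENNReal.ofReal_ne_top
      (fun b hb => ENNReal.ofReal_le_ofReal
        (sub_le_sub_left (sub_nonneg.mp (Γ.loss_nonneg hb)) _)) ?_ h ht
    intro h t ht
    exact Γ.value_le_deviate hk hmono hrec hC ht ((hσadm i).1 h t)
      (by rw [RevisionGame.profile, hσr])
  -- Along the prescribed path, shortfall from `C` and excess over the Nash payoff add pointwise to
  -- a constant, whose value is that constant.
  have hsum : ENNReal.ofReal (C - Γ.π Γ.aN Γ.aN) ≤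
      ∫⁻ ω, ENNReal.ofReal (C - Γ.realizedPayoff σ h t i ω) ∂Γ.arrivalLaw +
      ∫⁻ ω, ENNReal.ofReal (Γ.realizedPayoff (fun _ => Γ.lrStrategy x k) h t i ω -
        Γ.π Γ.aN Γ.aN) ∂Γ.arrivalLaw := by
    refine le_trans (le_of_eq ?_) (add_le_add hdev (Γ.value_le_lintegral_conform hx hxm i h ht))
    rw [← Γ.value_add ((Γ.measurable_comp_diag hx hxm h).const_sub _).ennreal_ofReal,
      ← Γ.value_const (ENNReal.ofReal (C - Γ.π Γ.aN Γ.aN)) ht]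
    congr 1
    ext s
    rw [← ENNReal.ofReal_add (sub_nonneg.mpr (hdiag h s))
      (Γ.loss_nonneg (Γ.lrStrategy_mem hx h s))]
    congr 1
    unfold RevisionGame.loss
    ring
  -- The deviation gains at most zero, which is at most `ε`.
  refine (RevisionGame.lintegral_sub_le_of_le_add
    (Γ.measurable_realizedPayoff hσadm h t i) hdevC hint hlow hsum).trans ?_
  have hε' : (0 : EReal) ≤ (ε : EReal) := by exact_mod_cast hε
  exact le_add_of_nonneg_right hε'
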